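/- Call a partial multivalued function $f:\subseteq X\rightrightarrows Y$ between represented spaces a problem, and write $\leq_{\mathrm W}$, $\equiv_{\mathrm W}$ for Weihrauch reducibility and Weihrauch equivalence of problems. For $k\in\mathbb N$ let $\mathbf k=\{0,\dots,k-1\}$. Let $\mathrm{TC}_{\mathbb N}$ be the problem that takes as input an enumeration of the complement of a set $A\subseteq\mathbb N$ and returns some $n\in A$ if $A\neq\emptyset$, and an arbitrary $n\in\mathbb N$ otherwise; let $\mathrm{TC}_{\mathbb N}^*$ be its finite parallelization, which takes as input a finite sequence (of any length, which is part of the input) of instances of $\mathrm{TC}_{\mathbb N}$ and returns a solution to each of them. Let $\mathrm{RT}^1_k$ be the problem that takes as input a colouring $c:\mathbb N\to\mathbf k$ and returns some $i\in\mathbf k$ such that $c^{-1}(i)$ is infinite. For a problem $f$, the $k$-finitary part $\operatorname{Fin}_k(f)$ is the greatest Weihrauch degree below $f$ that has a representative with codomain $\mathbf k$. Then for every $k\in\mathbb N$, $$\operatorname{Fin}_k(\mathrm{TC}_{\mathbb N}^*)\equiv_{\mathrm W}\mathrm{RT}^1_k .$$ That is, $\mathrm{RT}^1_k\leq_{\mathrm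 W}\mathrm{TC}_{\mathbb N}^*$, and every problem $h:\subseteq X\rightrightarrows\mathbf k$ on a represented space $X$ with $h\leq_{\mathrm W}\mathrm{TC}_{\mathbb N}^*$ satisfies $h\leq_{\mathrm W}\mathrm{RT}^1_k$. -/

import Mathlib

namespace Weihrauch

/-- The prefix `p 0, …, p (n - 1)` of a point `p` of Baire space. -/
def initSeg (p : ℕ → ℕ) (n : ℕ) : List ℕ := (List.range n).map p

/-- A computable partial functional on Baire space, presented by a computable word function that
is monotone for the prefix order (a Type-2 machine prints `word σ` while it has read only `σ`). -/
structure ComputableFunctional where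
  word : List ℕ → List ℕ
  computable : Computable word
  monotone : ∀ σ τ : List ℕ, σ <+: τ → word σ <+: word τ

/-- `F.MapsTo p q`: the functional `F` is defined at `p`, with value `q`. (If the words printed on
prefixes of `p` do not become arbitrarily long, then `F` is undefined at `p`.) -/
def ComputableFunctional.MapsTo (F : ComputableFunctional) (p q : ℕ → ℕ) : Prop :=
  ∀ n : ℕ, ∃ m : ℕ, initSeg q n <+: F.word (initSeg p m)

/-- The value of a computable partial functional is unique where it is defined. -/
theorem ComputableFunctional.MapsTo.unique {F : ComputableFunctional} {p q r : ℕ → ℕ}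
    (hq : F.MapsTo p q) (hr : F.MapsTo p r) : q = r := by
  funext n
  obtain ⟨a, ha⟩ := hq (n + 1)
  obtain ⟨b, hb⟩ := hr (n + 1)
  have hseg : ∀ {m m' : ℕ}, m ≤ m' → initSeg p m <+: initSeg p m' := by
    intro m m' h
    refine List.IsPrefix.map p ?_
    obtain ⟨d, rfl⟩ := Nat.exists_eq_add_of_le h
    rw [List.range_add]
    exact List.prefix_append _ _
  have ha' := ha.trans (F.monotone _ _ (hseg (le_max_left a b)))
  have hb' := hb.trans (F.monotone _ _ (hseg (le_max_right a b)))
  have hle := List.prefix_of_prefix_length_le ha' hb' (by simp [initSeg])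
  have heq := hle.eq_of_length (by simp [initSeg])
  have := List.map_inj_left.1 heq n (by simp)
  exact this

/-- The pairing `⟨p, q⟩` on Baire space: `p` at the even places and `q` at the odd places. -/
def interleave (p q : ℕ → ℕ) (n : ℕ) : ℕ :=
  if n % 2 = 0 then p (n / 2) else q (n / 2)

/-- A represented space: a set with a partial surjection from Baire space onto it, given by its
graph `IsName`. -/
structure RepresentedSpace where
  carrier : Type
  IsName : (ℕ → ℕ) → carrier → Prop
  unique : ∀ (p : ℕ → ℕ) (x y : carrier), IsName p x → IsName p y → x = y
  surjective : ∀ x : carrier, ∃ p : ℕ → ℕ, IsName p x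

/-- A partial multivalued function `f : ⊆ X ⇉ Y` between represented spaces.
Its domain is the set of all `x` for which `f x` is nonempty. -/
def Problem (X Y : RepresentedSpace) : Type := X.carrier → Set Y.carrier

/-- Weihrauch reducibility `f ≤_W g`: there are computable functionals `K` (inner) and `H` (outer)
such that for each name `p` of an instance `x` of `f`, `K p` is defined and names an instance `z`
of `g`, and for each name `q` of each solution of `z`, `H ⟨p, q⟩` is defined and names a solution
of `x`. -/
def Reducible {X Y Z W : RepresentedSpace} (f : Problem X Y) (g : Problem Z W) : Prop :=
  ∃ K H : ComputableFunctional, ∀ (p : ℕ → ℕ) (x : X.carrier), X.IsName p x → (f x).Nonempty →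
    ∃ (r : ℕ → ℕ) (z : Z.carrier), K.MapsTo p r ∧ Z.IsName r z ∧ (g z).Nonempty ∧
      ∀ (q : ℕ → ℕ) (w : W.carrier), W.IsName q w → w ∈ g z →
        ∃ (s : ℕ → ℕ) (y : Y.carrier), H.MapsTo (interleave p q) s ∧ Y.IsName s y ∧ y ∈ f x

/-- Weihrauch equivalence `f ≡_W g`. -/
def Equivalent {X Y Z W : RepresentedSpace} (f : Problem X Y) (g : Problem Z W) : Prop :=
  Reducible f g ∧ Reducible g f

/-- The discrete space `ℕ`: a name of `n` starts with `n`. -/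
def natSpace : RepresentedSpace where
  carrier := ℕ
  IsName p n := p 0 = n
  unique _ _ _ h h' := h.symm.trans h'
  surjective n := ⟨fun _ => n, rfl⟩

/-- The discrete space `𝐤 = {0, …, k - 1}`: a name of `i` starts with `i`. -/
def finSpace (k : ℕ) : RepresentedSpace where
  carrier := Fin k
  IsName p i := p 0 = i
  unique _ _ _ h h' := Fin.ext (h.symm.trans h')
  surjective i := ⟨fun _ => i, rfl⟩

/-- The space of all `k`-colourings of `ℕ`: a colouring is its own name. -/
def colouringSpace (k : ℕ) : RepresentedSpace where
  carrier := ℕ → Fin k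
  IsName p c := ∀ n, p n = c n
  unique _ _ _ h h' := funext fun n => Fin.ext ((h n).symm.trans (h' n))
  surjective c := ⟨fun n => c n, fun _ => rfl⟩

/-- The space of subsets of `ℕ` given by enumerations of the complement: a name of `A` lists
`n + 1` exactly for those `n` that are not in `A`; the entry `0` carries no information (so that
an empty complement has a name too). -/
def closedSetSpace : RepresentedSpace where
  carrier := Set ℕ
  IsName p A := ∀ n, n ∉ A ↔ ∃ m, p m = n + 1
  unique _ _ _ h h' := Set.ext fun n => not_iff_not.1 ((h n).trans (h' n).symm)
  surjective A := by
    classical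
    refine ⟨fun m => if m ∈ A then 0 else m + 1, fun n => ⟨fun h => ⟨n, by simp [h]⟩, ?_⟩⟩
    rintro ⟨m, hm⟩
    by_cases h : m ∈ A
    · simp [h] at hm
    · simp only [h, if_false, Nat.add_right_cancel_iff] at hm
      exact hm ▸ h

/-- The space `X^*` of finite sequences of points of `X`: a name consists of the length and of a
name of each entry. -/
def listSpace (X : RepresentedSpace) : RepresentedSpace where
  carrier := List X.carrier
  IsName p l := p 0 = l.length ∧
    ∀ (i : ℕ) (hi : i < l.length), X.IsName (fun m => p (Nat.pair i m + 1)) l[i]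
  unique _ _ _ h h' := List.ext_getElem (h.1.symm.trans h'.1)
    fun i hi hi' => X.unique _ _ _ (h.2 i hi) (h'.2 i hi')
  surjective l := by
    choose nm hnm using X.surjective
    refine ⟨fun n => Nat.casesOn n l.length fun t =>
      if h : t.unpair.1 < l.length then nm l[t.unpair.1] t.unpair.2 else 0, rfl, fun i hi => ?_⟩
    simpa [hi] using hnm l[i]

/-- Finite parallelization `f^* = ⨆ₙ f^n`: given finitely many (possibly no) instances of `f`,
solve all of them. -/
def finiteParallelization {X Y : RepresentedSpace} (f : Problem X Y) :
    Problem (listSpace X) (listSpace Y) :=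
  fun l => {l' | List.Forall₂ (fun x y => y ∈ f x) l l'}

/-- `TC_ℕ`: given an enumeration of the complement of `A ⊆ ℕ`, find an element of `A` if there is
one, and any natural number otherwise. -/
def TCN : Problem closedSetSpace natSpace :=
  fun (A : Set ℕ) => {n : ℕ | A.Nonempty → n ∈ A}

/-- `RT¹_k`: given `c : ℕ → 𝐤`, find a colour `i` such that `c ⁻¹ (i)` is infinite. -/
def RT1 (k : ℕ) : Problem (colouringSpace k) (finSpace k) :=
  fun (c : ℕ → Fin k) => {i : Fin k | (c ⁻¹' {i}).Infinite}

/-- `g` represents the degree `Fin_k(f)`, the `k`-finitary part of `f`: the degree of `g` is the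
greatest among the Weihrauch degrees that are below `f` and have a representative with
codomain `𝐤`. -/
def IsFinitaryPart (k : ℕ) {X Y Z W : RepresentedSpace} (f : Problem X Y) (g : Problem Z W) :
    Prop :=
  (∃ (V : RepresentedSpace) (h : Problem V (finSpace k)), Equivalent g h) ∧
  Reducible g f ∧
  ∀ (V : RepresentedSpace) (h : Problem V (finSpace k)), Reducible h f → Reducible h g

end Weihrauch

namespace Weihrauch

/-! ### Initial segments and functionals given by a step function -/

/-! `RT1 k` reduces to `k` instances of `TCN`: for each colour, ask for a bound beyond which it no
longer occurs. Colours occurring finitely often receive true bounds; the answers for the others are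
arbitrary, but can only enlarge the maximum. The colour found at the maximum of all answers
therefore occurs infinitely often (`RT1_reducible`).

Conversely, let `K`, `H` reduce `h` to the parallelization. At stage `t`, answer each set by its
least number not yet enumerated. For a nonempty set this is eventually an element; for an empty one
it may change forever, but every number is a solution. So from some stage on every guessed tuple is
correct, although the guesses need not converge (`exists_guessName_correct`). Running `H` on the
frozen guesses of various stages yields a colouring with values in `k`, all but finitely many of
which solve `h`; a colour used infinitely often is thus a solution (`reducible_RT1`). -/

theorem length_initSeg (p : ℕ → ℕ) (n : ℕ) : (initSeg p n).length = n := by simp [initSeg]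

theorem getElem?_initSeg (p : ℕ → ℕ) {n j : ℕ} (h : j < n) : (initSeg p n)[j]? = some (p j) := by
  simp [initSeg, h]

theorem take_initSeg (p : ℕ → ℕ) {m n : ℕ} (h : m ≤ n) : (initSeg p n).take m = initSeg p m := by
  simp [initSeg, ← List.map_take, List.take_range, h]

theorem getElem?_initSeg_eq_some {p : ℕ → ℕ} {n j a : ℕ} (h : (initSeg p n)[j]? = some a) :
    p j = a := by
  have hj : j < n := by
    simpa [length_initSeg] using (List.getElem?_eq_some_iff.1 h).1
  simpa [getElem?_initSeg p hj] using h

theorem initSeg_prefix (p : ℕ → ℕ) {m n : ℕ} (h : m ≤ n) : initSeg p m <+: initSeg p n := by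
  rw [← take_initSeg p h]
  exact List.take_prefix _ _

namespace ComputableFunctional

/-- Run through the words `f 0, …, f (n - 1)`, appending at each of them the symbol (if any) that
`g` proposes for the next place. -/
def run (g : List ℕ → ℕ → Option ℕ) (f : ℕ → List ℕ) (n : ℕ) : List ℕ :=
  Nat.rec [] (fun i out => out ++ (g (f i) out.length).toList) n

theorem run_succ (g : List ℕ → ℕ → Option ℕ) (f : ℕ → List ℕ) (n : ℕ) :
    run g f (n + 1) = run g f n ++ (g (f n) (run g f n).length).toList := rfl

theorem run_congr (g : List ℕ → ℕ → Option ℕ) {f f' : ℕ → List ℕ} {n : ℕ}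
    (h : ∀ i < n, f i = f' i) : run g f n = run g f' n := by
  induction n with
  | zero => rfl
  | succ n ih =>
    rw [run_succ, run_succ, ih fun i hi => h i (by omega), h n (by omega)]

theorem run_prefix (g : List ℕ → ℕ → Option ℕ) (f : ℕ → List ℕ) {m n : ℕ} (h : m ≤ n) :
    run g f m <+: run g f n := by
  induction n, h using Nat.le_induction with
  | base => exact List.prefix_rfl
  | succ n _ ih => exact ih.trans (List.prefix_append _ _)

theorem exists_of_getElem?_run {g : List ℕ → ℕ → Option ℕ} {f : ℕ → List ℕ} {n j a : ℕ}
    (h : (run g f n)[j]? = some a) : ∃ i, g (f i) j = some a := by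
  induction n with
  | zero => simp [run] at h
  | succ n ih =>
    rw [run_succ] at h
    rcases lt_or_ge j (run g f n).length with hj | hj
    · rw [List.getElem?_append_left hj] at h
      exact ih h
    · rw [List.getElem?_append_right hj] at h
      cases hg : g (f n) (run g f n).length with
      | none => simp [hg] at h
      | some b =>
        rw [hg, Option.toList_some, List.getElem?_singleton] at h
        split_ifs at h with h0
        obtain rfl : j = (run g f n).length := by omega
        exact ⟨n, hg.trans h⟩

/-- The output waits at place `j` until some proposal for `j` arrives, at a time not known in
advance; hence proposals are needed at arbitrarily late stages. -/
theorem exists_le_length_run {g : List ℕ → ℕ → Option ℕ} {f : ℕ → List ℕ}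
    (h : ∀ j N, ∃ i ≥ N, (g (f i) j).isSome) (L : ℕ) : ∃ n, L ≤ (run g f n).length := by
  induction L with
  | zero => exact ⟨0, Nat.zero_le _⟩
  | succ L ih =>
    obtain ⟨n, hn⟩ := ih
    obtain ⟨i, hi, hs⟩ := h L n
    have hle := hn.trans (run_prefix g f hi).length_le
    rcases hle.eq_or_lt with heq | hlt
    · obtain ⟨a, ha⟩ := Option.isSome_iff_exists.1 hs
      refine ⟨i + 1, ?_⟩
      rw [run_succ, ← heq, ha]
      simp [← heq]
    · exact ⟨i, hlt⟩

/-- The functional that, having printed `j` symbols, prints `a` upon reading a prefix `σ` of its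
input with `g σ j = some a`. -/
def ofStep (g : List ℕ → ℕ → Option ℕ) (hg : Computable₂ g) : ComputableFunctional where
  -- The `+ 1` includes `σ` itself among the prefixes consulted. Only prefixes of `σ` matter, which
  -- gives monotonicity.
  word σ := run g σ.take (σ.length + 1)
  computable := by
    refine Computable.nat_rec (f := fun σ : List ℕ => σ.length + 1)
      (h := fun σ x => x.2 ++ (g (σ.take x.1) x.2.length).toList)
      (Computable.succ.comp Computable.list_length)
      (Computable.const ([] : List ℕ)) (Computable₂.mk ?_)
    have hout : Computable fun x : List ℕ × ℕ × List ℕ => x.2.2 :=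
      Computable.snd.comp Computable.snd
    refine Computable.list_append.comp hout (Primrec.optionToList.to_comp.comp (hg.comp ?_ ?_))
    · exact Primrec.list_take.to_comp.comp (Computable.fst.comp Computable.snd) Computable.fst
    · exact Computable.list_length.comp hout
  monotone σ τ h := by
    have : run g σ.take (σ.length + 1) = run g τ.take (σ.length + 1) := by
      refine run_congr g fun i hi => ?_
      obtain ⟨ρ, rfl⟩ := h
      rw [List.take_append_of_le_length (by omega)]
    rw [this]
    exact run_prefix g _ (by have := h.length_le; omega)

/-- Proposals for the same place may disagree between stages: whichever is current when the place is
due gets printed and is never revised. So the value is only known to consist of symbols proposed at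
some stage, which suffices for printing guesses. -/
theorem ofStep_mapsTo (g : List ℕ → ℕ → Option ℕ) (hg : Computable₂ g) (p : ℕ → ℕ)
    (h : ∀ j N, ∃ i ≥ N, (g (initSeg p i) j).isSome) :
    ∃ s, (ofStep g hg).MapsTo p s ∧ ∀ j, ∃ i, g (initSeg p i) j = some (s j) := by
  have hword : ∀ m, (ofStep g hg).word (initSeg p m) = run g (initSeg p) (m + 1) := fun m => by
    change run g (initSeg p m).take ((initSeg p m).length + 1) = _
    rw [length_initSeg]
    exact run_congr g fun i hi => take_initSeg p (by omega)
  choose n hn using exists_le_length_run h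
  have hget : ∀ j, j < (run g (initSeg p) (n (j + 1))).length := fun j => hn (j + 1)
  refine ⟨fun j => (run g (initSeg p) (n (j + 1)))[j]'(hget j), fun L => ⟨n L, ?_⟩, fun j => ?_⟩
  · rw [hword]
    refine List.IsPrefix.trans ?_ (run_prefix g _ (Nat.le_succ _))
    rw [List.prefix_iff_eq_take, length_initSeg]
    refine List.ext_getElem (by simp [length_initSeg, hn L]) fun j h₁ h₂ => ?_
    have hjL : j < L := by simpa [length_initSeg] using h₁
    have hj : j < (run g (initSeg p) (n L)).length := hjL.trans_le (hn L)
    simp only [initSeg, List.getElem_map, List.getElem_range, List.getElem_take]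
    rcases le_total (n (j + 1)) (n L) with hle | hle
    · exact (run_prefix g _ hle).getElem (hget j)
    · exact ((run_prefix g _ hle).getElem hj).symm
  · exact exists_of_getElem?_run (List.getElem?_eq_getElem (hget j))

/-- A functional given by a step function has value `s` if the step function proposes the symbols
of `s`, and nothing else, on all sufficiently long prefixes. -/
theorem ofStep_mapsTo_of_eq (g : List ℕ → ℕ → Option ℕ) (hg : Computable₂ g) (p s : ℕ → ℕ)
    (hsome : ∀ j, ∃ N, ∀ i ≥ N, (g (initSeg p i) j).isSome)
    (heq : ∀ i j a, g (initSeg p i) j = some a → a = s j) : (ofStep g hg).MapsTo p s := by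
  obtain ⟨s', hs', h'⟩ := ofStep_mapsTo g hg p fun j N => by
    obtain ⟨M, hM⟩ := hsome j
    exact ⟨max M N, le_max_right _ _, hM _ (le_max_left _ _)⟩
  obtain rfl : s' = s := funext fun j => by
    obtain ⟨i, hi⟩ := h' j
    exact heq _ _ _ hi
  exact hs'

/-- Both words are prefixes of what `F` prints on a longer prefix of `p`. Thus a partial output of
`K` is a genuine prefix of the name it computes. -/
theorem MapsTo.word_eq {F : ComputableFunctional} {p q : ℕ → ℕ} (h : F.MapsTo p q) (t : ℕ) :
    F.word (initSeg p t) = initSeg q (F.word (initSeg p t)).length := by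
  obtain ⟨m, hm⟩ := h (F.word (initSeg p t)).length
  have h₁ := hm.trans (F.monotone _ _ (initSeg_prefix p (le_max_right t m)))
  have h₂ := F.monotone _ _ (initSeg_prefix p (le_max_left t m))
  exact ((List.prefix_of_prefix_length_le h₁ h₂ (by simp [length_initSeg])).eq_of_length
    (by simp [length_initSeg])).symm

theorem MapsTo.exists_le_length {F : ComputableFunctional} {p q : ℕ → ℕ} (h : F.MapsTo p q)
    (L : ℕ) : ∃ T, ∀ t ≥ T, L ≤ (F.word (initSeg p t)).length := by
  obtain ⟨m, hm⟩ := h L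
  refine ⟨m, fun t ht => ?_⟩
  simpa [length_initSeg] using (hm.trans (F.monotone _ _ (initSeg_prefix p ht))).length_le

/-- The identity on Baire space. -/
def identity : ComputableFunctional where
  word σ := σ
  computable := Computable.id
  monotone _ _ h := h

theorem identity_mapsTo (p : ℕ → ℕ) : identity.MapsTo p p := fun n => ⟨n, List.prefix_rfl⟩

theorem computable_getElem?_odd :
    Computable₂ fun (σ : List ℕ) (j : ℕ) => σ[2 * j + 1]? :=
  (Primrec.list_getElem?.comp Primrec.fst
    (Primrec.succ.comp (Primrec.nat_mul.comp (Primrec.const 2) Primrec.snd))).to_comp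

/-- The second projection of the pairing `interleave`. -/
def oddPart : ComputableFunctional := ofStep _ computable_getElem?_odd

theorem oddPart_mapsTo (p q : ℕ → ℕ) : oddPart.MapsTo (interleave p q) q := by
  refine ofStep_mapsTo_of_eq _ _ _ _ (fun j => ⟨2 * j + 2, fun i hi => ?_⟩) fun i j a h => ?_
  · rw [getElem?_initSeg _ (by omega)]
    rfl
  · rw [← getElem?_initSeg_eq_some h, interleave, if_neg (by omega)]
    congr 1
    omega

end ComputableFunctional

open ComputableFunctional

theorem interleave_even (p q : ℕ → ℕ) (n : ℕ) : interleave p q (2 * n) = p n := by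
  simp [interleave]

theorem interleave_odd (p q : ℕ → ℕ) (n : ℕ) : interleave p q (2 * n + 1) = q n := by
  rw [interleave, if_neg (by omega)]
  congr 1
  omega

theorem Reducible.refl {X Y : RepresentedSpace} (f : Problem X Y) : Reducible f f :=
  ⟨identity, oddPart, fun p x hp hx => ⟨p, x, identity_mapsTo p, hp, hx, fun q w hq hw =>
    ⟨q, w, oddPart_mapsTo p q, hq, hw⟩⟩⟩

/-! ### Reducing `RT¹_k` to the finite parallelization of `TC_ℕ` -/

/-- The places from which on the colour `i` does not occur in `c`. -/
def lastBound {k : ℕ} (c : ℕ → Fin k) (i : ℕ) : Set ℕ := {n | ∀ m ≥ n, (c m : ℕ) ≠ i}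

/-- The symbol that the colour `c` at the place `m.unpair.1` contributes at index `m` to the
enumeration of the complement of the set `lastBound` for the colour `i`. -/
def boundSymbol (i m c : ℕ) : ℕ :=
  -- An occurrence of `i` at a place `≥ n` refutes `n` as a bound; `m` codes the pair (place, `n`).
  if c = i ∧ m.unpair.2 ≤ m.unpair.1 then m.unpair.2 + 1 else 0

/-- The step function that turns a colouring into `k` instances of `TC_ℕ`. -/
def boundsStep (k : ℕ) (σ : List ℕ) (j : ℕ) : Option ℕ :=
  if j = 0 then some k
  else σ[(j - 1).unpair.2.unpair.1]?.map (boundSymbol (j - 1).unpair.1 (j - 1).unpair.2)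

theorem computable_boundsStep (k : ℕ) : Computable₂ (boundsStep k) := by
  have hj : Primrec fun x : List ℕ × ℕ => (x.2 - 1).unpair :=
    Primrec.unpair.comp (Primrec.pred.comp Primrec.snd)
  have hu : Primrec fun x : List ℕ × ℕ => (x.2 - 1).unpair.2.unpair :=
    Primrec.unpair.comp (Primrec.snd.comp hj)
  refine Primrec.to_comp (f := fun x : List ℕ × ℕ => boundsStep k x.1 x.2) ?_
  refine Primrec.ite (Primrec.eq.comp Primrec.snd (Primrec.const 0)) (Primrec.const _)
    (Primrec.option_map (Primrec.list_getElem?.comp Primrec.fst (Primrec.fst.comp hu)) ?_)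
  refine Primrec.ite (PrimrecPred.and
    (Primrec.eq.comp Primrec.snd (Primrec.fst.comp (hj.comp Primrec.fst)))
    (Primrec.nat_le.comp (Primrec.snd.comp (hu.comp Primrec.fst))
      (Primrec.fst.comp (hu.comp Primrec.fst))))
    (Primrec.succ.comp (Primrec.snd.comp (hu.comp Primrec.fst))) (Primrec.const 0)

/-- The maximum of the first `k` answers, read off from a prefix of `⟨p, q⟩`, where `q` names the
list of answers. -/
def maxAnswer : ℕ → List ℕ → Option ℕ
  | 0, _ => some 0
  -- Answer `k` is symbol `0` of entry `k`, at place `Nat.pair k 0 + 1` of `q`; `q` occupies the odd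
  -- places.
  | k + 1, σ => (maxAnswer k σ).bind fun a => σ[2 * (Nat.pair k 0 + 1) + 1]?.map (max a)

theorem primrec_maxAnswer (k : ℕ) : Primrec (maxAnswer k) := by
  induction k with
  | zero => exact Primrec.const _
  | succ k ih =>
    refine Primrec.option_bind ih (Primrec.option_map
      (Primrec.list_getElem?.comp Primrec.fst (Primrec.const _)) ?_)
    exact Primrec.nat_max.comp (Primrec.snd.comp Primrec.fst) Primrec.snd

/-- The maximum of the first `k` answers in the list named by `q`. -/
def maxAnswerOf (q : ℕ → ℕ) (k : ℕ) : ℕ :=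
  (List.range k).foldl (fun a i => max a (q (Nat.pair i 0 + 1))) 0

theorem maxAnswerOf_succ (q : ℕ → ℕ) (k : ℕ) :
    maxAnswerOf q (k + 1) = max (maxAnswerOf q k) (q (Nat.pair k 0 + 1)) := by
  simp [maxAnswerOf, List.range_succ]

theorem le_maxAnswerOf (q : ℕ → ℕ) {k i : ℕ} (h : i < k) :
    q (Nat.pair i 0 + 1) ≤ maxAnswerOf q k := by
  induction k with
  | zero => omega
  | succ k ih =>
    rw [maxAnswerOf_succ]
    rcases (Nat.lt_succ_iff_lt_or_eq.1 h) with h | rfl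
    · exact (ih h).trans (le_max_left _ _)
    · exact le_max_right _ _

theorem maxAnswer_eq_some {p q : ℕ → ℕ} {k n a : ℕ}
    (h : maxAnswer k (initSeg (interleave p q) n) = some a) : a = maxAnswerOf q k := by
  induction k generalizing a with
  | zero => simpa [maxAnswer, maxAnswerOf, eq_comm] using h
  | succ k ih =>
    obtain ⟨b, hb, h⟩ := Option.bind_eq_some_iff.1 h
    obtain ⟨c, hc, rfl⟩ := Option.map_eq_some_iff.1 h
    rw [maxAnswerOf_succ, ← ih hb, ← getElem?_initSeg_eq_some hc, interleave_odd]

theorem exists_maxAnswer (p q : ℕ → ℕ) (k : ℕ) :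
    ∃ N, ∀ n ≥ N, maxAnswer k (initSeg (interleave p q) n) = some (maxAnswerOf q k) := by
  induction k with
  | zero => exact ⟨0, fun _ _ => rfl⟩
  | succ k ih =>
    obtain ⟨N, hN⟩ := ih
    refine ⟨max N (2 * (Nat.pair k 0 + 1) + 2), fun n hn => ?_⟩
    rw [maxAnswer, hN n (by omega), Option.bind_some, getElem?_initSeg _ (by omega),
      interleave_odd, maxAnswerOf_succ]
    rfl

/-- The step function that answers with the colour at the maximum of all the bounds. -/
def colourAtStep (k : ℕ) (σ : List ℕ) (_ : ℕ) : Option ℕ :=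
  (maxAnswer k σ).bind fun a => σ[2 * a]?

theorem computable_colourAtStep (k : ℕ) : Computable₂ (colourAtStep k) := by
  refine Primrec.to_comp (f := fun x : List ℕ × ℕ => colourAtStep k x.1 x.2) ?_
  refine Primrec.option_bind ((primrec_maxAnswer k).comp Primrec.fst) ?_
  exact Primrec.list_getElem?.comp (Primrec.fst.comp Primrec.fst)
    (Primrec.nat_mul.comp (Primrec.const 2) Primrec.snd)

theorem colourAtStep_mapsTo (k : ℕ) (p q : ℕ → ℕ) :
    (ofStep (colourAtStep k) (computable_colourAtStep k)).MapsTo (interleave p q)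
      fun _ => p (maxAnswerOf q k) := by
  refine ofStep_mapsTo_of_eq _ _ _ _ (fun j => ?_) fun i j a h => ?_
  · obtain ⟨N, hN⟩ := exists_maxAnswer p q k
    refine ⟨max N (2 * maxAnswerOf q k + 1), fun i hi => ?_⟩
    rw [colourAtStep, hN i (by omega), Option.bind_some, getElem?_initSeg _ (by omega)]
    rfl
  · obtain ⟨b, hb, h⟩ := Option.bind_eq_some_iff.1 h
    rw [← getElem?_initSeg_eq_some h, interleave_even, maxAnswer_eq_some hb]

theorem boundsStep_mapsTo (k : ℕ) (p : ℕ → ℕ) :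
    (ofStep (boundsStep k) (computable_boundsStep k)).MapsTo p fun j => if j = 0 then k else
      boundSymbol (j - 1).unpair.1 (j - 1).unpair.2 (p (j - 1).unpair.2.unpair.1) := by
  refine ofStep_mapsTo_of_eq _ _ _ _
    (fun j => ⟨(j - 1).unpair.2.unpair.1 + 1, fun i hi => ?_⟩) fun i j a h => ?_
  · rw [boundsStep, getElem?_initSeg _ (by omega)]
    split_ifs <;> rfl
  · rw [boundsStep] at h
    split_ifs at h ⊢ with hj
    · exact (Option.some.inj h).symm
    · obtain ⟨b, hb, rfl⟩ := Option.map_eq_some_iff.1 h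
      rw [getElem?_initSeg_eq_some hb]

theorem isName_lastBound {k : ℕ} {p : ℕ → ℕ} {c : ℕ → Fin k} (hp : ∀ n, p n = c n) (i : ℕ) :
    closedSetSpace.IsName (fun m => boundSymbol i m (p m.unpair.1)) (lastBound c i) := by
  intro n
  simp only [lastBound, Set.mem_ofPred_eq, not_forall, not_not, boundSymbol, exists_prop]
  constructor
  · rintro ⟨m, hm, h⟩
    exact ⟨Nat.pair m n, by simp [hp, h, hm]⟩
  · rintro ⟨m, hm⟩
    split_ifs at hm with h
    obtain rfl : m.unpair.2 = n := by omega
    exact ⟨_, h.2, (hp _).symm.trans h.1⟩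

theorem mem_finiteParallelization_TCN {l : List (Set ℕ)} {w : List ℕ} :
    w ∈ finiteParallelization TCN l ↔
      List.Forall₂ (fun (A : Set ℕ) (n : ℕ) => A.Nonempty → n ∈ A) l w := Iff.rfl

theorem isName_list_nat {q : ℕ → ℕ} {w : List ℕ} : (listSpace natSpace).IsName q w ↔
    q 0 = w.length ∧ ∀ (i : ℕ) (hi : i < w.length), q (Nat.pair i 0 + 1) = w[i] := Iff.rfl

theorem isName_list_closedSet {q : ℕ → ℕ} {l : List (Set ℕ)} :
    (listSpace closedSetSpace).IsName q l ↔ q 0 = l.length ∧ ∀ (i : ℕ) (hi : i < l.length),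
      closedSetSpace.IsName (fun m => q (Nat.pair i m + 1)) l[i] := Iff.rfl

theorem finiteParallelization_TCN_nonempty (l : List (Set ℕ)) :
    (finiteParallelization TCN l).Nonempty := by
  have h : ∀ A : Set ℕ, ∃ n, A.Nonempty → n ∈ A := fun A => by
    by_cases hA : A.Nonempty
    · exact ⟨hA.some, fun _ => hA.some_mem⟩
    · exact ⟨0, fun h => absurd h hA⟩
  choose a ha using h
  have h : List.Forall₂ (fun (A : Set ℕ) (n : ℕ) => A.Nonempty → n ∈ A) l (l.map a) := by
    rw [List.forall₂_map_right_iff]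
    exact List.forall₂_same.2 fun A _ => ha A
  exact ⟨_, mem_finiteParallelization_TCN.2 h⟩

theorem RT1_reducible (k : ℕ) : Reducible (RT1 k) (finiteParallelization TCN) := by
  refine ⟨ofStep _ (computable_boundsStep k), ofStep _ (computable_colourAtStep k), ?_⟩
  intro p (c : ℕ → Fin k) (hp : ∀ n, p n = c n) _
  obtain ⟨l, hlk, hl⟩ : ∃ l : List (Set ℕ), l.length = k ∧
      ∀ (i : ℕ) (hi : i < l.length), l[i] = lastBound c i :=
    ⟨(List.range k).map (lastBound c), by simp, by simp⟩
  refine ⟨_, l, boundsStep_mapsTo k p, isName_list_closedSet.2 ⟨hlk.symm, fun i hi => ?_⟩,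
    finiteParallelization_TCN_nonempty _,
    fun q (w : List ℕ) hq hw => ?_⟩
  · simpa [hl] using isName_lastBound hp i
  · refine ⟨_, c (maxAnswerOf q k), colourAtStep_mapsTo k p q, hp _, ?_⟩
    intro hfin
    set i := c (maxAnswerOf q k) with hi
    obtain ⟨hlen, hw⟩ := List.forall₂_iff_get.1 (mem_finiteParallelization_TCN.1 hw)
    have hik : (i : ℕ) < w.length := by rw [← hlen, hlk]; exact i.isLt
    have hqi : q (Nat.pair i 0 + 1) = w[(i : ℕ)] := (isName_list_nat.1 hq).2 i hik
    have hmem : (lastBound c i).Nonempty → q (Nat.pair i 0 + 1) ∈ lastBound c i := by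
      rw [hqi]
      simpa [hl] using hw i (hlen.symm ▸ hik) hik
    obtain ⟨b, hb⟩ := hfin.bddAbove
    -- If `i` occurred only finitely often, its answer would be a true bound below the maximum,
    -- where `i` nevertheless occurs.
    have hne : (lastBound c i).Nonempty :=
      ⟨b + 1, fun m hm h => by have := hb (show m ∈ c ⁻¹' {i} from Fin.ext h); omega⟩
    exact hmem hne _ (le_maxAnswerOf q i.isLt) rfl

/-! ### Reducing problems with codomain `𝐤` to `RT¹_k` -/

/-- `v + 1` occurs in the `i`-th entry of the list of which `ρ` is a prefix of a name. -/
def Listed (ρ : List ℕ) (i v : ℕ) : Prop :=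
  ∃ m < ρ.length, ρ[Nat.pair i m + 1]? = some (v + 1)

instance (ρ : List ℕ) (i v : ℕ) : Decidable (Listed ρ i v) :=
  inferInstanceAs (Decidable (∃ m < ρ.length, ρ[Nat.pair i m + 1]? = some (v + 1)))

/-- The least number not yet enumerated out of the `i`-th set in the list of which `ρ` is a prefix
of a name. -/
def guess (ρ : List ℕ) (i : ℕ) : ℕ :=
  -- Distinct listed numbers sit at distinct places of `ρ`, so one of `ρ.length + 1` candidates is
  -- always unlisted.
  (List.range (ρ.length + 1)).findIdx fun v => !decide (Listed ρ i v)

theorem primrec_listed : Primrec fun x : (List ℕ × ℕ) × ℕ => decide (Listed x.1.1 x.1.2 x.2) := by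
  have hR : PrimrecRel fun (m : ℕ) (x : (List ℕ × ℕ) × ℕ) =>
      x.1.1[Nat.pair x.1.2 m + 1]? = some (x.2 + 1) := by
    have hx : Primrec fun y : ℕ × (List ℕ × ℕ) × ℕ => y.2.1 := Primrec.fst.comp Primrec.snd
    exact Primrec.eq.comp
      (Primrec.list_getElem?.comp (Primrec.fst.comp hx)
        (Primrec.succ.comp (Primrec₂.natPair.comp (Primrec.snd.comp hx) Primrec.fst)))
      (Primrec.option_some.comp (Primrec.succ.comp (Primrec.snd.comp Primrec.snd)))
  have h := hR.exists_mem_list.comp (Primrec.list_range.comp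
    (Primrec.list_length.comp (Primrec.fst.comp (Primrec.fst (α := List ℕ × ℕ) (β := ℕ)))))
    Primrec.id
  exact PrimrecPred.decide (h.of_eq fun x => by simp [Listed])

theorem primrec_guess : Primrec₂ guess := by
  refine Primrec.list_findIdx
    (Primrec.list_range.comp (Primrec.succ.comp (Primrec.list_length.comp Primrec.fst))) ?_
  exact Primrec.not.comp primrec_listed

/-- The guessed name of a list of answers to the list of which `ρ` is a prefix of a name. -/
def guessName (ρ : List ℕ) (l : ℕ) : ℕ :=
  if l = 0 then ρ.getD 0 0 else guess ρ (l - 1).unpair.1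

theorem primrec_guessName : Primrec₂ guessName := by
  refine Primrec.ite (Primrec.eq.comp Primrec.snd (Primrec.const 0))
    ((Primrec.list_getD 0).comp Primrec.fst (Primrec.const 0)) (primrec_guess.comp Primrec.fst ?_)
  exact Primrec.fst.comp (Primrec.unpair.comp (Primrec.pred.comp Primrec.snd))

/-- A prefix of the pairing of the point continuing `σ` with the guessed name of answers. -/
def weave (σ ρ : List ℕ) : List ℕ :=
  (List.range σ.length).map fun l =>
    if l % 2 = 0 then σ.getD (l / 2) 0 else guessName ρ (l / 2)

theorem primrec_weave : Primrec₂ weave := by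
  have hl : Primrec fun y : (List ℕ × List ℕ) × ℕ => y.2 / 2 :=
    Primrec.nat_div.comp Primrec.snd (Primrec.const 2)
  refine Primrec.list_map (Primrec.list_range.comp (Primrec.list_length.comp Primrec.fst)) ?_
  exact Primrec.ite
    (Primrec.eq.comp (Primrec.nat_mod.comp Primrec.snd (Primrec.const 2)) (Primrec.const 0))
    ((Primrec.list_getD 0).comp (Primrec.fst.comp Primrec.fst) hl)
    (primrec_guessName.comp (Primrec.snd.comp Primrec.fst) hl)

theorem weave_initSeg (p : ℕ → ℕ) (n : ℕ) (ρ : List ℕ) :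
    weave (initSeg p n) ρ = initSeg (interleave p (guessName ρ)) n := by
  rw [weave, length_initSeg]
  change _ = (List.range n).map _
  refine List.map_congr_left fun l hl => ?_
  have hl : l < n := List.mem_range.1 hl
  rw [interleave, List.getD_eq_getElem?_getD]
  split_ifs
  · rw [getElem?_initSeg p (show l / 2 < n by omega)]
    rfl
  · rfl

/-- Given a reduction `K`, `H` to a problem on lists of closed sets, guess answers from what is
known at stage `t` and propose the value that `H` computes from them. Here `t` is coded into the
length of `σ`, and has to be at least `j`. -/
def guessStep (K H : ComputableFunctional) (k : ℕ) (σ : List ℕ) (j : ℕ) : Option ℕ :=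
  -- The guess depends on the first `t` symbols only, so it stays frozen while `H` reads ever longer
  -- inputs; a stage on which `H` diverges blocks no other.
  (H.word (weave σ (K.word (σ.take σ.length.unpair.1)))).head?.bind fun c =>
    -- `j ≤ t` leaves only finitely many places to early, possibly wrong guesses; `c < k` keeps even
    -- their values legal colours.
    if j ≤ σ.length.unpair.1 ∧ c < k then some c else none

theorem computable_guessStep (K H : ComputableFunctional) (k : ℕ) :
    Computable₂ (guessStep K H k) := by
  have ht : Primrec fun x : List ℕ × ℕ => x.1.length.unpair.1 :=
    Primrec.fst.comp (Primrec.unpair.comp (Primrec.list_length.comp Primrec.fst))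
  have hρ : Computable fun x : List ℕ × ℕ => K.word (x.1.take x.1.length.unpair.1) :=
    K.computable.comp (Primrec.list_take.comp ht Primrec.fst).to_comp
  refine Computable.option_bind (Primrec.list_head?.to_comp.comp
    (H.computable.comp (primrec_weave.to_comp.comp Computable.fst hρ))) ?_
  refine Primrec.to_comp (f := fun y : (List ℕ × ℕ) × ℕ =>
    if y.1.2 ≤ y.1.1.length.unpair.1 ∧ y.2 < k then some y.2 else none) ?_
  exact Primrec.ite (PrimrecPred.and
    (Primrec.nat_le.comp (Primrec.snd.comp Primrec.fst) (ht.comp Primrec.fst))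
    (Primrec.nat_lt.comp Primrec.snd (Primrec.const k)))
    (Primrec.option_some.comp Primrec.snd) (Primrec.const none)

/-- From some stage on, the guess for a nonempty set is an element of it. -/
theorem exists_guess_mem {r : ℕ → ℕ} {i : ℕ} {A : Set ℕ}
    (hr : closedSetSpace.IsName (fun m => r (Nat.pair i m + 1)) A) (hA : A.Nonempty) :
    ∃ N, ∀ n ≥ N, guess (initSeg r n) i ∈ A := by
  classical
  have hv := Nat.find_spec hA
  have hmin : ∀ v < Nat.find hA, v ∉ A := fun v hv => Nat.find_min hA hv
  set v := Nat.find hA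
  have hex : ∀ u, ∃ m, u ∉ A → r (Nat.pair i m + 1) = u + 1 := fun u => by
    by_cases hu : u ∈ A
    · exact ⟨0, fun h => absurd hu h⟩
    · obtain ⟨m, hm⟩ := (hr u).1 hu
      exact ⟨m, fun _ => hm⟩
  choose m hm using hex
  -- Long enough for `v` to be among the candidates and for every `u < v` to have been enumerated.
  refine ⟨v + (Finset.range v).sup (fun u => Nat.pair i (m u) + 2), fun n hn => ?_⟩
  suffices h : guess (initSeg r n) i = v by rwa [h]
  rw [guess, List.findIdx_eq (by simp [length_initSeg]; omega)]
  simp only [List.getElem_range, Bool.not_eq_true', decide_eq_false_iff_not, Bool.not_eq_false',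
    decide_eq_true_eq]
  refine ⟨?_, fun u hu => ?_⟩
  · rintro ⟨m, -, h⟩
    exact (hr v).2 ⟨m, getElem?_initSeg_eq_some h⟩ hv
  · have hle := Finset.le_sup (f := fun u => Nat.pair i (m u) + 2) (Finset.mem_range.2 hu)
    have hpair := Nat.right_le_pair i (m u)
    refine ⟨m u, by rw [length_initSeg]; omega, ?_⟩
    rw [getElem?_initSeg r (by omega), hm u (hmin u hu)]

/-- From some stage on, the guessed name is a name of a list of correct answers. -/
theorem exists_guessName_correct {r : ℕ → ℕ} {l : List (Set ℕ)}
    (hr : (listSpace closedSetSpace).IsName r l) :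
    ∃ N, ∀ n ≥ N, ∃ w : List ℕ, (listSpace natSpace).IsName (guessName (initSeg r n)) w ∧
      w ∈ finiteParallelization TCN l := by
  have hex : ∀ i, ∃ N, ∀ n ≥ N, ∀ hi : i < l.length, l[i].Nonempty →
      guess (initSeg r n) i ∈ l[i] := fun i => by
    by_cases h : ∃ hi : i < l.length, l[i].Nonempty
    · obtain ⟨hi, hne⟩ := h
      obtain ⟨N, hN⟩ := exists_guess_mem ((isName_list_closedSet.1 hr).2 i hi) hne
      exact ⟨N, fun n hn _ _ => hN n hn⟩
    · exact ⟨0, fun n _ hi hne => absurd ⟨hi, hne⟩ h⟩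
  choose N hN using hex
  -- The `1 +` ensures that place `0`, the length of the list, has been read.
  refine ⟨1 + (Finset.range l.length).sup N, fun n hn => ?_⟩
  refine ⟨(List.range l.length).map (guess (initSeg r n)),
    isName_list_nat.2 ⟨?_, fun i hi => ?_⟩, mem_finiteParallelization_TCN.2 ?_⟩
  · have h0 := (isName_list_closedSet.1 hr).1
    rw [guessName, if_pos rfl, List.getD_eq_getElem?_getD, getElem?_initSeg r (by omega)]
    simpa using h0
  · simp [guessName]
  · refine List.forall₂_iff_get.2 ⟨by simp, fun i hi hi' => ?_⟩
    have hle := Finset.le_sup (f := N) (Finset.mem_range.2 hi)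
    simpa using hN i n (by omega) hi

theorem head?_word_of_mapsTo {F : ComputableFunctional} {p q : ℕ → ℕ} (h : F.MapsTo p q) {n a : ℕ}
    (ha : (F.word (initSeg p n)).head? = some a) : a = q 0 := by
  rw [h.word_eq n, List.head?_eq_getElem?] at ha
  exact (getElem?_initSeg_eq_some ha).symm

theorem reducible_RT1 {k : ℕ} {V : RepresentedSpace} (h : Problem V (finSpace k))
    (hred : Reducible h (finiteParallelization TCN)) : Reducible h (RT1 k) := by
  obtain ⟨K, H, hKH⟩ := hred
  refine ⟨ofStep _ (computable_guessStep K H k), oddPart, fun p x hp hx => ?_⟩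
  obtain ⟨r, l, hKr, hr, -, hsol⟩ := hKH p x hp hx
  obtain ⟨T, hT⟩ : ∃ T, ∀ t ≥ T, ∃ (s : ℕ → ℕ) (y : Fin k),
      H.MapsTo (interleave p (guessName (K.word (initSeg p t)))) s ∧ s 0 = y ∧ y ∈ h x := by
    obtain ⟨N, hN⟩ := exists_guessName_correct hr
    obtain ⟨T, hT⟩ := hKr.exists_le_length N
    refine ⟨T, fun t ht => ?_⟩
    obtain ⟨w, hw, hwl⟩ := hN _ (hT t ht)
    rw [← hKr.word_eq t] at hw
    exact hsol _ w hw hwl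
  have hstep : ∀ i j, guessStep K H k (initSeg p i) j =
      (H.word (initSeg (interleave p (guessName (K.word (initSeg p i.unpair.1)))) i)).head?.bind
        fun c => if j ≤ i.unpair.1 ∧ c < k then some c else none := fun i j => by
    rw [guessStep, length_initSeg, take_initSeg p (Nat.unpair_left_le i), weave_initSeg]
  obtain ⟨s, hs, hval⟩ := ofStep_mapsTo _ (computable_guessStep K H k) p fun j N => by
    obtain ⟨s, y, hHs, hsy, -⟩ := hT (max j T) (le_max_right _ _)
    obtain ⟨M, hM⟩ := hHs.exists_le_length 1
    have hge := Nat.right_le_pair (max j T) (max M N)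
    -- Stage `max j T` has a correct guess and passes the test `j ≤ t`; the second component makes
    -- the prefix long enough for `H` to print and the index at least `N`.
    refine ⟨Nat.pair (max j T) (max M N), by omega, ?_⟩
    rw [hstep, Nat.unpair_pair]
    have hlen := hM (Nat.pair (max j T) (max M N)) (by omega)
    obtain ⟨a, ha⟩ := Option.isSome_iff_exists.1
      (List.isSome_head?.2 (List.ne_nil_of_length_pos hlen))
    have hak : a < k := by rw [head?_word_of_mapsTo hHs ha, hsy]; exact y.isLt
    simp [ha, hak]
  have hspec : ∀ j, s j < k ∧ (T ≤ j → ∃ y : Fin k, s j = y ∧ y ∈ h x) := fun j => by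
    obtain ⟨i, hi⟩ := hval j
    rw [hstep] at hi
    obtain ⟨c, hc, hi⟩ := Option.bind_eq_some_iff.1 hi
    split_ifs at hi with hcond
    obtain rfl : c = s j := Option.some.inj hi
    refine ⟨hcond.2, fun hTj => ?_⟩
    obtain ⟨s', y, hHs, hsy, hy⟩ := hT _ (hTj.trans hcond.1)
    exact ⟨y, (head?_word_of_mapsTo hHs hc).trans hsy, hy⟩
  refine ⟨s, fun j => (⟨s j, (hspec j).1⟩ : Fin k), hs, fun _ => rfl, ?_, ?_⟩
  · obtain ⟨y, hy⟩ := Finite.exists_infinite_fiber fun j => (⟨s j, (hspec j).1⟩ : Fin k)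
    exact ⟨y, Set.infinite_coe_iff.1 hy⟩
  · intro q (y : Fin k) hq (hy : Set.Infinite _)
    -- An infinitely recurring colour appears beyond `T`, where every value solves `h`.
    obtain ⟨j, hj, hTj⟩ := hy.exists_gt T
    obtain ⟨y', hy', hmem⟩ := (hspec j).2 hTj.le
    have hyj : s j = y := congrArg Fin.val hj
    obtain rfl : y' = y := Fin.ext (hy'.symm.trans hyj)
    exact ⟨q, y', oddPart_mapsTo p q, hq, hmem⟩

end Weihrauch

theorem proposition24 (k : ℕ) :
    Weihrauch.IsFinitaryPart k (Weihrauch.finiteParallelization Weihrauch.TCN)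
      (Weihrauch.RT1 k) := by
  refine ⟨⟨_, Weihrauch.RT1 k, ?_⟩, Weihrauch.RT1_reducible k, fun _ h => Weihrauch.reducible_RT1 h⟩
  exact ⟨Weihrauch.Reducible.refl _, Weihrauch.Reducible.refl _⟩
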